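/- For $n\ge 5$ let $S\subset A_n$ be the set of all $3$-cycles in $S_n$ and let $CAG_n=\mathrm{Cay}(A_n,S)$ be the complete alternating group graph: the graph with vertex set $A_n$ in which $\gamma$ and $t\gamma$ are adjacent for all $\gamma\in A_n$, $t\in S$. Inside the symmetric group on the set $A_n$, let $R(A_n)=\{x\mapsto x\gamma \mid \gamma\in A_n\}$ be the right regular representation of $A_n$, let $\mathrm{Inn}(S_n)=\{x\mapsto gxg^{-1}\mid g\in S_n\}$ be the group of inner automorphisms of $S_n$ acting on $A_n$, and let $h$ be the inversion $\alpha\mapsto\alpha^{-1}$, which has order $2$, so that $\langle h\rangle\cong\mathbb{Z}_2$. Then the full automorphism group of $CAG_n$ is $$\mathrm{Aut}(CAG_n)=(R(A_n)\rtimes \mathrm{Inn}(S_n))\rtimes\langle h\rangle\cong (A_n\rtimes S_n)\rtimes\mathbb{Z}_2 .$$ The equality is an equality of permutation groups, with both semidirect products internal. On the right, $S_n$ acts on $A_n$ by conjugation, and the generator of $\mathbb{Z}_2$ acts on $A_n\rtimes S_n$ by $(a,g)\mapsto(a^{-1},ag)$. The isomorphism can be chosen to take $a\in A_n$ to $x\mapsto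 xa^{-1}$, $g\in S_n$ to $x\mapsto gxg^{-1}$, and the generator of $\mathbb{Z}_2$ to $h$. In particular, $|\mathrm{Aut}(CAG_n)|=(n!)^2$. -/

import Mathlib

namespace CompleteAlternating

/-- The Cayley graph `Cay(Γ, T)` in the left-multiplication convention: the edges are the pairs
`{γ, t * γ}` with `γ ∈ Γ` and `t ∈ T`. (Mathlib's `SimpleGraph.mulCayley` has the edges
`{γ, γ * t}`.) -/
def cayleyGraph {Γ : Type*} [Group Γ] (T : Set Γ) : SimpleGraph Γ :=
  SimpleGraph.fromRel fun x y => ∃ t ∈ T, y = t * x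

/-- The set of all 3-cycles of `S_n`, as a subset of `A_n`. -/
def threeCycles (n : ℕ) : Set (alternatingGroup (Fin n)) :=
  {t | (t : Equiv.Perm (Fin n)).IsThreeCycle}

/-- The complete alternating group graph `CAG_n = Cay(A_n, S)`, `S` the set of 3-cycles. -/
def CAG (n : ℕ) : SimpleGraph (alternatingGroup (Fin n)) :=
  cayleyGraph (threeCycles n)

/-- The automorphism group of a graph, as a subgroup of the symmetric group on its vertices. -/
def autGroup {V : Type*} (X : SimpleGraph V) : Subgroup (Equiv.Perm V) where
  carrier := {f | ∃ φ : X ≃g X, φ.toEquiv = f}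
  mul_mem' := by
    rintro _ _ ⟨φ, rfl⟩ ⟨χ, rfl⟩
    exact ⟨φ * χ, rfl⟩
  one_mem' := ⟨1, rfl⟩
  inv_mem' := by
    rintro _ ⟨φ, rfl⟩
    exact ⟨φ⁻¹, rfl⟩

/-- The right regular representation `R(Γ) = {x ↦ x * γ | γ ∈ Γ}`. -/
def rightRegular (Γ : Type*) [Group Γ] : Subgroup (Equiv.Perm Γ) where
  carrier := {f | ∃ γ : Γ, ∀ x, f x = x * γ}
  mul_mem' := by
    rintro f g ⟨a, ha⟩ ⟨b, hb⟩
    exact ⟨b * a, fun x => by rw [Equiv.Perm.mul_apply, hb, ha, mul_assoc]⟩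
  one_mem' := ⟨1, fun x => (mul_one x).symm⟩
  inv_mem' := by
    rintro f ⟨a, ha⟩
    exact ⟨a⁻¹, fun x => by rw [Equiv.Perm.inv_eq_iff_eq, ha, inv_mul_cancel_right]⟩

/-- The inner automorphisms `x ↦ g * x * g⁻¹` of `S_n`, as permutations of `A_n`. -/
def innOnAlternating (n : ℕ) : Subgroup (Equiv.Perm (alternatingGroup (Fin n))) where
  carrier := {f | ∃ g : Equiv.Perm (Fin n), ∀ x, (f x : Equiv.Perm (Fin n)) = MulAut.conj g x}
  mul_mem' := by
    rintro f k ⟨a, ha⟩ ⟨b, hb⟩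
    exact ⟨a * b, fun x => by rw [Equiv.Perm.mul_apply, ha, hb, map_mul, MulAut.mul_apply]⟩
  one_mem' := ⟨1, fun x => by simp⟩
  inv_mem' := by
    rintro f ⟨a, ha⟩
    refine ⟨a⁻¹, fun x => ?_⟩
    have h := ha (f⁻¹ x)
    rw [show f (f⁻¹ x) = x from f.apply_symm_apply x] at h
    rw [h, ← MulAut.mul_apply, ← map_mul, inv_mul_cancel, map_one, MulAut.one_apply]

/-- The map `h : α ↦ α⁻¹` on `A_n`. -/
def inversion (n : ℕ) : Equiv.Perm (alternatingGroup (Fin n)) :=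
  Equiv.inv (alternatingGroup (Fin n))

/-- `G` is the internal semidirect product `N ⋊ H` of its subgroups `N` and `H`: `N` is normal in
`G`, and every element of `G` is uniquely a product of an element of `N` and one of `H`. -/
structure IsInternalSemidirect {P : Type*} [Group P] (N H G : Subgroup P) : Prop where
  left_le : N ≤ G
  right_le : H ≤ G
  normal : (N.subgroupOf G).Normal
  isComplement : (N.subgroupOf G).IsComplement' (H.subgroupOf G)

/-- The semidirect product `A_n ⋊ S_n` for the conjugation action of `S_n` on `A_n`. -/
abbrev AltSemidirectSym (n : ℕ) : Type :=
  alternatingGroup (Fin n) ⋊[MulAut.conjNormal] Equiv.Perm (Fin n)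

/-- The involutory automorphism `(a, g) ↦ (a⁻¹, a * g)` of `A_n ⋊ S_n`. -/
def twist (n : ℕ) : MulAut (AltSemidirectSym n) where
  toFun p := ⟨p.left⁻¹, p.left * p.right⟩
  invFun p := ⟨p.left⁻¹, p.left * p.right⟩
  left_inv p := by ext <;> simp
  right_inv p := by ext <;> simp
  map_mul' p q := by
    apply SemidirectProduct.ext
    · apply Subtype.ext
      simp [mul_assoc]
    · simp [mul_assoc]

theorem twist_sq (n : ℕ) : twist n ^ 2 = 1 := by
  rw [pow_two]
  exact MulEquiv.ext (twist n).left_inv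

/-- The action of `ℤ/2` on `A_n ⋊ S_n` whose generator acts by `twist n`. -/
def twistAction (n : ℕ) : Multiplicative (ZMod 2) →* MulAut (AltSemidirectSym n) where
  toFun t := twist n ^ t.toAdd.val
  map_one' := by simp
  map_mul' s t := by
    rw [toAdd_mul, ZMod.val_add, ← pow_eq_pow_mod _ (twist_sq n), pow_add]

/-- The group `(A_n ⋊ S_n) ⋊ ℤ/2`. -/
abbrev AltSymTwo (n : ℕ) : Type :=
  AltSemidirectSym n ⋊[twistAction n] Multiplicative (ZMod 2)

end CompleteAlternating

open CompleteAlternating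

/-! Right translations, conjugations by `S_n` and inversion are clearly automorphisms; the content
is that they generate all of them. After a right translation an automorphism φ fixes 1, so it
permutes the 3-cycles. Distinct 3-cycles a, b are adjacent iff b = a⁻¹ or they share an arc i → j
(`isThreeCycle_mul_inv_iff`), and among 3-cycles only edges of the second kind lie in triangles. So
φ preserves inversion and arc sharing. Two 3-cycles through i → j determine that arc, so φ induces a
map of arcs. The arcs leaving a point go to arcs with a common tail or a common head
(`IsArcMap.star`), with the same alternative at all points (`IsArcMap.orientation`). Hence φ acts on
3-cycles as a conjugation, possibly after inversion (`ArcPreserving.exists_conj`).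

Undoing these, φ fixes 1 and every 3-cycle. Seen from a neighbour s, φ again acts on 3-cycles in
this form, and it fixes those sharing an arc with s⁻¹, which is enough to make it trivial there
(`eq_one_of_conj_eq_or`). Being fixed together with all neighbours thus spreads along edges, and
3-cycles generate `A_n`. The group structure is read off from x ↦ g x^{±1} g⁻¹ c. -/

namespace CompleteAlternating

/-! ### 3-cycles, their arcs, and adjacency between them -/

open Equiv

variable {α : Type*}

/-- `a` is the 3-cycle `(i j k)`. -/
def CycAt (a : Perm α) (i j k : α) : Prop :=
  i ≠ j ∧ j ≠ k ∧ i ≠ k ∧ a i = j ∧ a j = k ∧ a k = i ∧ ∀ x, x = i ∨ x = j ∨ x = k ∨ a x = x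

/-- `a` and `b` share an arc `i → j`, `i ≠ j`. -/
def SharesArc (a b : Perm α) : Prop :=
  ∃ i, a i = b i ∧ a i ≠ i

theorem SharesArc.symm {a b : Perm α} (h : SharesArc a b) : SharesArc b a := by
  obtain ⟨i, h1, h2⟩ := h
  exact ⟨i, h1.symm, h1 ▸ h2⟩

namespace CycAt

theorem rotate {a : Perm α} {i j k : α} (h : CycAt a i j k) : CycAt a j k i := by
  obtain ⟨h1, h2, h3, h4, h5, h6, h7⟩ := h
  exact ⟨h2, h3.symm, h1.symm, h5, h6, h4, by grind⟩

theorem inv {a : Perm α} {i j k : α} (h : CycAt a i j k) : CycAt a⁻¹ i k j := by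
  obtain ⟨h1, h2, h3, h4, h5, h6, h7⟩ := h
  refine ⟨h3, h2.symm, h1, ?_, ?_, ?_, fun x => ?_⟩ <;> rw [Perm.inv_eq_iff_eq]
  · exact h6.symm
  · exact h5.symm
  · exact h4.symm
  · grind

theorem ext {a b : Perm α} {i j k : α} (ha : CycAt a i j k) (hb : CycAt b i j k) : a = b := by
  ext x
  unfold CycAt at ha hb
  grind

theorem mul_self {a : Perm α} {i j k : α} (h : CycAt a i j k) : CycAt (a * a) i k j := by
  unfold CycAt at h ⊢
  simp only [Perm.mul_apply]
  grind

variable [DecidableEq α]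

theorem swap_mul_swap {i j k : α} (h1 : i ≠ j) (h2 : j ≠ k) (h3 : i ≠ k) :
    CycAt (swap i j * swap j k) i j k := by
  refine ⟨h1, h2, h3, ?_, ?_, ?_, fun x => ?_⟩ <;> simp only [Perm.mul_apply, swap_apply_def] <;>
    grind

variable [Fintype α]

theorem isThreeCycle {a : Perm α} {i j k : α} (h : CycAt a i j k) : a.IsThreeCycle := by
  obtain ⟨h1, h2, h3, -⟩ := id h
  rw [h.ext (swap_mul_swap h1 h2 h3), swap_comm]
  exact Perm.isThreeCycle_swap_mul_swap_same h1.symm h2 h3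

end CycAt

theorem exists_cycAt [DecidableEq α] {i j k : α} (h1 : i ≠ j) (h2 : j ≠ k) (h3 : i ≠ k) :
    ∃ a : Perm α, CycAt a i j k :=
  ⟨_, CycAt.swap_mul_swap h1 h2 h3⟩

variable [DecidableEq α] [Fintype α]

theorem cycAt_of_isThreeCycle {a : Perm α} (h : a.IsThreeCycle) {i : α} (hi : a i ≠ i) :
    CycAt a i (a i) (a (a i)) := by
  have hs := Perm.mem_support.2 hi
  have h1 := h.nodup_iff_mem_support.2 hs
  have h2 := h.eq_swap_mul_swap_iff_mem_support.2 hs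
  simp only [List.nodup_cons, List.mem_cons, List.not_mem_nil, or_false, not_or] at h1
  have := CycAt.swap_mul_swap h1.1.1 h1.2.1 h1.1.2
  rwa [← h2] at this

theorem exists_cycAt_of_isThreeCycle {a : Perm α} (h : a.IsThreeCycle) :
    ∃ i j k, CycAt a i j k := by
  obtain ⟨i, hi⟩ := Finset.card_pos.1 (h.card_support.symm ▸ three_pos : 0 < a.support.card)
  exact ⟨i, _, _, cycAt_of_isThreeCycle h (Perm.mem_support.1 hi)⟩

theorem cycAt_or_cycAt_of_ne {a : Perm α} (h : a.IsThreeCycle) {i j k : α} (hij : i ≠ j)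
    (hjk : j ≠ k) (hik : i ≠ k) (hi : a i ≠ i) (hj : a j ≠ j) (hk : a k ≠ k) :
    CycAt a i j k ∨ CycAt a i k j := by
  have h := cycAt_of_isThreeCycle h hi
  unfold CycAt at h ⊢
  grind

/-- The arcs `i → j` and `p → q` of two 3-cycles sharing both of them coincide. -/
theorem arc_unique {a b : Perm α} (ha : a.IsThreeCycle) (hb : b.IsThreeCycle) (hab : a ≠ b)
    {i j : α} (hi : a i = b i) (hi' : a i ≠ i) (hj : a j = b j) (hj' : a j ≠ j) : i = j := by
  by_contra hij
  have h1 := cycAt_of_isThreeCycle ha hi'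
  have h2 := cycAt_of_isThreeCycle hb (hi ▸ hi')
  rw [← hi] at h2
  have : a (a i) = b (a i) := by
    unfold CycAt at h1 h2
    grind
  rw [← this] at h2
  exact hab (h1.ext h2)

theorem sharesArc_refl {a : Perm α} (ha : a.IsThreeCycle) : SharesArc a a := by
  obtain ⟨i, j, k, h⟩ := exists_cycAt_of_isThreeCycle ha
  exact ⟨i, rfl, by rw [h.2.2.2.1]; exact h.1.symm⟩

theorem not_sharesArc_inv {a : Perm α} (ha : a.IsThreeCycle) : ¬ SharesArc a a⁻¹ := by
  rintro ⟨i, h1, h2⟩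
  have h := cycAt_of_isThreeCycle ha h2
  have h' := h.inv
  unfold CycAt at h h'
  grind

/-- A 3-cycle shares an arc with two 3-cycles through `i → j` only if it passes through `i → j`. -/
theorem sharesArc_and_sharesArc_iff {a b c : Perm α} (ha : a.IsThreeCycle) (hb : b.IsThreeCycle)
    (hc : c.IsThreeCycle) (hab : a ≠ b) {i j : α} (hij : i ≠ j) (hai : a i = j) (hbi : b i = j) :
    SharesArc c a ∧ SharesArc c b ↔ c i = j := by
  constructor
  · rintro ⟨⟨p, hp, hp'⟩, q, hq, hq'⟩
    have h1 := cycAt_of_isThreeCycle ha (i := i) (by grind)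
    have h2 := cycAt_of_isThreeCycle hb (i := i) (by grind)
    rw [hai] at h1
    rw [hbi] at h2
    -- For a = (i j k), b = (i j l), k ≠ l, an arc of a and an arc of b, both other than i → j,
    -- never lie on one 3-cycle: they have equal tails, equal heads, or four distinct ends.
    have h3 : a j ≠ b j := fun h => hij (arc_unique ha hb hab (hai.trans hbi.symm) (by grind) h
      (by unfold CycAt at h1; grind))
    have h4 := cycAt_of_isThreeCycle hc hp'
    unfold CycAt at h1 h2 h4
    grind
  · intro h
    exact ⟨⟨i, by grind, by grind⟩, i, by grind, by grind⟩

/-- Without a shared arc, b * a⁻¹ moves all three points of a, so it is a or a⁻¹, and b is a² = a⁻¹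
or 1. Conversely (i j k) and (i j l) give the product (k l i). -/
theorem isThreeCycle_mul_inv_iff {a b : Perm α} (ha : a.IsThreeCycle) (hb : b.IsThreeCycle)
    (hab : a ≠ b) : (b * a⁻¹).IsThreeCycle ↔ b = a⁻¹ ∨ SharesArc a b := by
  constructor
  · intro hc
    by_contra! h
    obtain ⟨h1, h2⟩ := h
    have key : ∀ x, a x ≠ x → b (a⁻¹ x) ≠ x := fun x hx hb' =>
      h2 ⟨a⁻¹ x, by rw [hb']; simp, by
        intro h3
        apply hx
        have : a (a⁻¹ x) = x := by simp
        rw [h3] at this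
        rw [← this, h3, this]⟩
    obtain ⟨i, j, k, h⟩ := exists_cycAt_of_isThreeCycle ha
    obtain ⟨hij, hjk, hik, hai, haj, hak, -⟩ := id h
    rcases cycAt_or_cycAt_of_ne hc hij hjk hik (key i (hai ▸ hij.symm)) (key j (haj ▸ hjk.symm))
      (key k (hak ▸ hik)) with h3 | h3
    · have h4 : b = a * a := mul_inv_eq_iff_eq_mul.1 (h3.ext h)
      exact h1 (h4.trans (h.mul_self.ext h.inv))
    · exact hb.ne_one (by simpa using h3.ext h.inv)
  · rintro (rfl | ⟨i, h1, h2⟩)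
    · exact ha.inv.isThreeCycle_sq
    · have h := cycAt_of_isThreeCycle ha h2
      have h' := cycAt_of_isThreeCycle hb (h1 ▸ h2)
      rw [← h1] at h'
      have hi := h.inv
      have h3 : a (a i) ≠ b (a i) := fun h3 => hab (h.ext (by rwa [← h3] at h'))
      refine CycAt.isThreeCycle (i := a (a i)) (j := b (a i)) (k := i) ?_
      unfold CycAt at h h' hi ⊢
      simp only [Perm.mul_apply]
      grind

theorem exists_ne_of_card {s : Finset α} (h : s.card < Fintype.card α) : ∃ x, x ∉ s := by
  by_contra! h'
  rw [Finset.eq_univ_of_forall h', Finset.card_univ] at h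
  exact h.false

/-- In the graph induced on the 3-cycles, an edge lies in a triangle iff its ends share an arc. -/
theorem sharesArc_iff_exists_common_neighbor (hα : 5 ≤ Fintype.card α) {a b : Perm α}
    (ha : a.IsThreeCycle) (hb : b.IsThreeCycle) (hab : a ≠ b) :
    SharesArc a b ↔ (b * a⁻¹).IsThreeCycle ∧
      ∃ c : Perm α, c.IsThreeCycle ∧ (c * a⁻¹).IsThreeCycle ∧ (c * b⁻¹).IsThreeCycle := by
  rw [isThreeCycle_mul_inv_iff ha hb hab]
  constructor
  · intro h
    refine ⟨Or.inr h, ?_⟩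
    obtain ⟨i, h1, h2⟩ := h
    -- A third 3-cycle through the shared arc must avoid up to four points, hence 5 ≤ |α|.
    obtain ⟨m, hm⟩ := exists_ne_of_card (s := {i, a i, a (a i), b (a i)})
      (lt_of_le_of_lt Finset.card_le_four (by omega))
    simp only [Finset.mem_insert, Finset.mem_singleton, not_or] at hm
    obtain ⟨c, hc⟩ := exists_cycAt (i := i) (j := a i) (k := m) h2.symm (Ne.symm hm.2.1)
      (Ne.symm hm.1)
    have hc' := hc.isThreeCycle
    unfold CycAt at hc
    refine ⟨c, hc', ?_, ?_⟩
    · rw [isThreeCycle_mul_inv_iff ha hc' (by grind)]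
      exact Or.inr ⟨i, by grind, by grind⟩
    · rw [isThreeCycle_mul_inv_iff hb hc' (by grind)]
      exact Or.inr ⟨i, by grind, by grind⟩
  · rintro ⟨rfl | h, c, hc, h1, h2⟩
    -- If b = a⁻¹, then c shares different arcs with a and a⁻¹. They cover the points of c, so c is
    -- a or a⁻¹, which share no arc.
    · have hca : c ≠ a := by rintro rfl; simpa using h1.ne_one
      have hcb : c ≠ a⁻¹ := by rintro rfl; simpa using h2.ne_one
      rw [isThreeCycle_mul_inv_iff ha hc hca.symm] at h1
      rw [isThreeCycle_mul_inv_iff hb hc hcb.symm, inv_inv] at h2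
      obtain ⟨p, hp, hp'⟩ := h1.resolve_left hcb
      obtain ⟨q, hq, hq'⟩ := h2.resolve_left hca
      have h3 := cycAt_of_isThreeCycle ha hp'
      have h4 := h3.inv
      have h5 := cycAt_of_isThreeCycle hc (hp ▸ hp')
      clear hca hcb hab
      unfold CycAt at h3 h4 h5
      grind
    · exact h

end CompleteAlternating

/-! ### Maps of 3-cycles that preserve arc sharing -/

namespace CompleteAlternating

open Equiv

variable {α : Type*} [DecidableEq α] [Fintype α]

/-- A map which is injective on 3-cycles, and preserves inversion and sharing of arcs. -/
structure ArcPreserving (f : Perm α → Perm α) : Prop where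
  isThreeCycle : ∀ a, a.IsThreeCycle → (f a).IsThreeCycle
  inj : ∀ a b, a.IsThreeCycle → b.IsThreeCycle → f a = f b → a = b
  inv : ∀ a, a.IsThreeCycle → f a⁻¹ = (f a)⁻¹
  sharesArc : ∀ a b, a.IsThreeCycle → b.IsThreeCycle → (SharesArc (f a) (f b) ↔ SharesArc a b)

/-- `P i j → Q i j` is the arc to which `f` sends the arc `i → j`. -/
def IsArcMap (f : Perm α → Perm α) (P Q : α → α → α) : Prop :=
  ∀ i j, i ≠ j → P i j ≠ Q i j ∧ ∀ a : Perm α, a.IsThreeCycle → (a i = j ↔ f a (P i j) = Q i j)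

theorem exists_isThreeCycle_pair (hα : 5 ≤ Fintype.card α) {i j : α} (hij : i ≠ j) (k : α) :
    ∃ a b : Perm α, a.IsThreeCycle ∧ b.IsThreeCycle ∧ a ≠ b ∧ a i = j ∧ b i = j ∧
      a j ≠ k ∧ b j ≠ k := by
  obtain ⟨l, hl⟩ := exists_ne_of_card (s := {i, j, k})
    (lt_of_le_of_lt Finset.card_le_three (by omega))
  obtain ⟨m, hm⟩ := exists_ne_of_card (s := {i, j, k, l})
    (lt_of_le_of_lt Finset.card_le_four (by omega))
  simp only [Finset.mem_insert, Finset.mem_singleton, not_or] at hl hm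
  obtain ⟨a, ha⟩ := exists_cycAt (i := i) (j := j) (k := l) hij (Ne.symm hl.2.1) (Ne.symm hl.1)
  obtain ⟨b, hb⟩ := exists_cycAt (i := i) (j := j) (k := m) hij (Ne.symm hm.2.1) (Ne.symm hm.1)
  have ha' := ha.isThreeCycle
  have hb' := hb.isThreeCycle
  unfold CycAt at ha hb
  exact ⟨a, b, ha', hb', by grind, by grind, by grind, by grind, by grind⟩

/-- Passing through i → j means sharing an arc with each of two distinct 3-cycles through it, a
condition that f preserves. -/
theorem ArcPreserving.exists_isArcMap (hα : 5 ≤ Fintype.card α) {f : Perm α → Perm α}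
    (hf : ArcPreserving f) : ∃ P Q, IsArcMap f P Q := by
  have key : ∀ i j : α, ∃ p q, i ≠ j → p ≠ q ∧
      ∀ a : Perm α, a.IsThreeCycle → (a i = j ↔ f a p = q) := by
    intro i j
    by_cases hij : i = j
    · exact ⟨i, j, fun h => absurd hij h⟩
    obtain ⟨a, b, ha, hb, hab, hai, hbi, -⟩ := exists_isThreeCycle_pair hα hij i
    obtain ⟨p, hp, hp'⟩ := (hf.sharesArc a b ha hb).2 ⟨i, hai.trans hbi.symm, hai ▸ Ne.symm hij⟩
    refine ⟨p, f a p, fun _ => ⟨hp'.symm, fun c hc => ?_⟩⟩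
    rw [← sharesArc_and_sharesArc_iff ha hb hc hab hij hai hbi,
      ← sharesArc_and_sharesArc_iff (hf.isThreeCycle a ha) (hf.isThreeCycle b hb)
        (hf.isThreeCycle c hc) (fun h => hab (hf.inj a b ha hb h)) hp'.symm rfl hp.symm,
      hf.sharesArc c a hc ha, hf.sharesArc c b hc hb]
  choose P Q h using key
  exact ⟨P, Q, h⟩

namespace IsArcMap

variable {f : Perm α → Perm α} {P Q : α → α → α}

/-- Inversion reverses arcs, so the images of two 3-cycles through i → j share both P i j → Q i j
and Q j i → P j i; these coincide by `arc_unique`. -/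
theorem reverse (hα : 5 ≤ Fintype.card α) (hf : ArcPreserving f) (h : IsArcMap f P Q) {i j : α}
    (hij : i ≠ j) : P j i = Q i j := by
  obtain ⟨a, b, ha, hb, hab, hai, hbi, -⟩ := exists_isThreeCycle_pair hα hij i
  obtain ⟨h1, h2⟩ := h i j hij
  obtain ⟨h3, h4⟩ := h j i hij.symm
  have key : ∀ c : Perm α, c.IsThreeCycle → c i = j → f c (P i j) = Q i j ∧
      f c (Q j i) = P j i := by
    intro c hc hci
    refine ⟨(h2 c hc).1 hci, ?_⟩
    have := (h4 c⁻¹ hc.inv).1 (by rw [Perm.inv_eq_iff_eq, hci])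
    rw [hf.inv c hc, Perm.inv_eq_iff_eq] at this
    exact this.symm
  obtain ⟨k1, k2⟩ := key a ha hai
  obtain ⟨k3, k4⟩ := key b hb hbi
  have := arc_unique (hf.isThreeCycle a ha) (hf.isThreeCycle b hb)
    (fun h => hab (hf.inj a b ha hb h)) (k1.trans k3.symm) (k1 ▸ h1.symm) (k2.trans k4.symm)
    (k2 ▸ h3)
  rw [← k2, ← this, k1]

/-- Equal tails force equal heads, by looking at the image of (i j k); then every 3-cycle through i
→ j would also pass through j → k. -/
theorem tail_ne (hα : 5 ≤ Fintype.card α) (h : IsArcMap f P Q) {i j k : α}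
    (hij : i ≠ j) (hjk : j ≠ k) (hik : i ≠ k) : P i j ≠ P j k := by
  intro hP
  obtain ⟨a, ha⟩ := exists_cycAt hij hjk hik
  have ha' := ha.isThreeCycle
  obtain ⟨-, -, -, hai, haj, -⟩ := ha
  have hQ : Q i j = Q j k := by
    rw [← ((h i j hij).2 a ha').1 hai, ← ((h j k hjk).2 a ha').1 haj, hP]
  obtain ⟨b, -, hb, -, -, hbi, -, hbj, -⟩ := exists_isThreeCycle_pair hα hij k
  apply hbj
  rw [(h j k hjk).2 b hb, ← hP, ← hQ, ← (h i j hij).2 b hb, hbi]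

/-- Two distinct arcs of one 3-cycle are consecutive, but f may reverse their order. -/
theorem consecutive (hα : 5 ≤ Fintype.card α) (hf : ArcPreserving f) (h : IsArcMap f P Q)
    {i j k : α} (hij : i ≠ j) (hjk : j ≠ k) (hik : i ≠ k) : Q i j = P j k ∨ Q j k = P i j := by
  have hP := h.tail_ne hα hij hjk hik
  obtain ⟨a, ha⟩ := exists_cycAt hij hjk hik
  have ha' := ha.isThreeCycle
  obtain ⟨-, -, -, hai, haj, -⟩ := ha
  obtain ⟨h1, h2⟩ := h i j hij
  obtain ⟨h3, h4⟩ := h j k hjk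
  rw [h2 a ha'] at hai
  rw [h4 a ha'] at haj
  have := cycAt_of_isThreeCycle (hf.isThreeCycle a ha') (hai.symm ▸ h1.symm)
  clear hf h h2 h4 hα
  unfold CycAt at this
  grind

/-- As points (tail, head) of a grid, the images of the arcs leaving j lie pairwise in a common row
or column, hence all in one. -/
theorem star (hα : 5 ≤ Fintype.card α) (hf : ArcPreserving f) (h : IsArcMap f P Q) (j : α) :
    (∃ t, ∀ i, i ≠ j → P j i = t) ∨ (∃ t, ∀ i, i ≠ j → Q j i = t) := by
  have key : ∀ i k, i ≠ j → k ≠ j → i ≠ k → P j i = P j k ∨ Q j i = Q j k := by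
    intro i k hi hk hik
    rcases h.consecutive hα hf hi hk.symm hik with h1 | h1
    · exact Or.inl (by rw [h.reverse hα hf hi, h1])
    · exact Or.inr (by rw [← h.reverse hα hf hi.symm, h1])
  obtain ⟨i, hi⟩ := exists_ne_of_card (s := {j}) (by rw [Finset.card_singleton]; omega)
  rw [Finset.mem_singleton] at hi
  by_cases h0 : ∀ k, k ≠ j → P j k = P j i
  · exact Or.inl ⟨_, h0⟩
  · push Not at h0
    obtain ⟨k, hk, hki⟩ := h0
    refine Or.inr ⟨Q j i, fun l hl => ?_⟩
    have hQ := (key k i hk hi (by rintro rfl; exact hki rfl)).resolve_left hki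
    by_cases hli : l = i
    · rw [hli]
    by_cases hlk : l = k
    · rw [hlk, hQ]
    have h1 := key l i hl hi hli
    have h2 := key l k hl hk hlk
    grind

/-- If j has constant tail t and k has constant head s, reversing j → k gives t = s. Then j → l and
l → k have images with equal tails, against `tail_ne`. -/
theorem orientation (hα : 5 ≤ Fintype.card α) (hf : ArcPreserving f) (h : IsArcMap f P Q) :
    (∀ j, ∃ t, ∀ i, i ≠ j → P j i = t) ∨ (∀ j, ∃ t, ∀ i, i ≠ j → Q j i = t) := by
  by_contra! h0
  obtain ⟨⟨k, hk⟩, j, hj⟩ := h0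
  obtain ⟨t, ht⟩ := (h.star hα hf j).resolve_right (by push Not; exact hj)
  obtain ⟨s, hs⟩ := (h.star hα hf k).resolve_left (by push Not; exact hk)
  have hjk : j ≠ k := by
    rintro rfl
    obtain ⟨i, hi, hi'⟩ := hk t
    exact hi' (ht i hi)
  obtain ⟨l, hl⟩ := exists_ne_of_card (s := {j, k})
    (lt_of_le_of_lt Finset.card_le_two (by omega))
  simp only [Finset.mem_insert, Finset.mem_singleton, not_or] at hl
  apply h.tail_ne hα (Ne.symm hl.1) hl.2 hjk
  rw [h.reverse hα hf (Ne.symm hl.2), ht l hl.1, hs l hl.2, ← hs j hjk, ← ht k hjk.symm,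
    h.reverse hα hf hjk.symm]

end IsArcMap

omit [Fintype α] in
theorem eq_conj_of_arcs {b c g : Perm α} (h : ∀ x y, x ≠ y → (b x = y ↔ c (g x) = g y)) :
    c = g * b * g⁻¹ := by
  rw [eq_mul_inv_iff_mul_eq]
  ext x
  simp only [Perm.mul_apply]
  by_cases hx : b x = x
  · obtain ⟨y, hy⟩ := g.surjective (c (g x))
    by_cases hxy : x = y
    · rw [hx, ← hy, ← hxy]
    · exact absurd (hx.symm.trans ((h x y hxy).2 hy.symm)) hxy
  · exact (h x _ (Ne.symm hx)).1 rfl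

omit [DecidableEq α] in
theorem exists_perm_of_ne (g : α → α) (h : ∀ i j, i ≠ j → g i ≠ g j) :
    ∃ g' : Perm α, ∀ x, g' x = g x :=
  ⟨Equiv.ofBijective g (Finite.injective_iff_bijective.1 fun i j hij => by_contra fun hne =>
    h i j hne hij), fun _ => rfl⟩

/-- The maps of 3-cycles which preserve inversion and sharing of arcs are induced by
conjugation, possibly followed by inversion. -/
theorem ArcPreserving.exists_conj (hα : 5 ≤ Fintype.card α) {f : Perm α → Perm α}
    (hf : ArcPreserving f) : ∃ g : Perm α,
      (∀ a : Perm α, a.IsThreeCycle → f a = g * a * g⁻¹) ∨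
      (∀ a : Perm α, a.IsThreeCycle → f a = g * a⁻¹ * g⁻¹) := by
  obtain ⟨P, Q, h⟩ := hf.exists_isArcMap hα
  -- The common tail (or head) at j defines g j; the arc i → j goes to g i → g j (or g j → g i).
  rcases h.orientation hα hf with h1 | h1 <;> choose g hg using h1
  · have hQ : ∀ i j, i ≠ j → Q i j = g j := fun i j hij => by
      rw [← h.reverse hα hf hij, hg j i hij]
    obtain ⟨g', hg'⟩ := exists_perm_of_ne g fun i j hij => by
      rw [← hg i j hij.symm, ← hQ i j hij]
      exact (h i j hij).1
    refine ⟨g', Or.inl fun a ha => eq_conj_of_arcs fun x y hxy => ?_⟩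
    rw [(h x y hxy).2 a ha, hQ x y hxy, hg x y hxy.symm, hg', hg']
  · have hP : ∀ i j, i ≠ j → P i j = g j := fun i j hij => by
      rw [h.reverse hα hf hij.symm, hg j i hij]
    obtain ⟨g', hg'⟩ := exists_perm_of_ne g fun i j hij => by
      rw [← hg i j hij.symm, ← hP i j hij]
      exact (h i j hij).1.symm
    refine ⟨g', Or.inr fun a ha => eq_conj_of_arcs fun x y hxy => ?_⟩
    rw [Perm.inv_eq_iff_eq, eq_comm, (h y x hxy.symm).2 a ha, hP y x hxy.symm, hg y x hxy, hg', hg']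

/-! ### Rigidity of conjugation on 3-cycles -/

/-- If a permutation preserves the support of every 3-cycle sharing an arc with a fixed one, it
is trivial. -/
theorem eq_one_of_preserves_support (hα : 5 ≤ Fintype.card α) {r g : Perm α}
    (hr : r.IsThreeCycle)
    (h : ∀ t : Perm α, t.IsThreeCycle → SharesArc t r → ∀ x, t x ≠ x → t (g x) ≠ g x) :
    g = 1 := by
  obtain ⟨i, j, k, hc⟩ := exists_cycAt_of_isThreeCycle hr
  have h1 : ∀ i j k w, CycAt r i j k → w ≠ i → w ≠ j →
      ∀ x, (x = i ∨ x = j ∨ x = w) → (g x = i ∨ g x = j ∨ g x = w) := by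
    intro i j k w hc hi hj x hx
    obtain ⟨t, ht⟩ := exists_cycAt hc.1 hj.symm hi.symm
    have := h t ht.isThreeCycle ⟨i, by rw [ht.2.2.2.1, hc.2.2.2.1], ht.2.2.2.1 ▸ hc.1.symm⟩ x
    unfold CycAt at ht
    grind
  have h2 : ∀ w, w ≠ i → w ≠ j → w ≠ k → g w = w ∧ g i = i ∧ g j = j ∧ g k = k := by
    intro w hi hj hk
    -- The invariant triples {i, j, w}, {j, k, w}, {k, i, w} meet only in w, so g fixes w; their
    -- pairwise intersections then give i, j and k.
    have k1 := h1 i j k w hc hi hj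
    have k2 := h1 j k i w hc.rotate hj hk
    have k3 := h1 k i j w hc.rotate.rotate hk hi
    have inj : ∀ x y, g x = g y → x = y := fun x y => g.injective.eq_iff.1
    have := hc.1
    have := hc.2.1
    have := hc.2.2.1
    clear h h1 hα hr hc
    have kw : g w = w := by grind
    grind
  obtain ⟨w, hw⟩ := exists_ne_of_card (s := {i, j, k})
    (lt_of_le_of_lt Finset.card_le_three (by omega))
  simp only [Finset.mem_insert, Finset.mem_singleton, not_or] at hw
  have h3 := h2 w hw.1 hw.2.1 hw.2.2
  ext x
  rw [Perm.one_apply]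
  by_cases hi : x = i
  · rw [hi, h3.2.1]
  by_cases hj : x = j
  · rw [hj, h3.2.2.1]
  by_cases hk : x = k
  · rw [hk, h3.2.2.2]
  exact (h2 x hi hj hk).1

/-- Both alternatives make g preserve the support of t. Testing only t that share an arc with r
matters in `fixes_mul_of_fixes_threeCycles`, where no more is known. -/
theorem eq_one_of_conj_eq_or (hα : 5 ≤ Fintype.card α) {r g : Perm α} (hr : r.IsThreeCycle)
    (h : ∀ t : Perm α, t.IsThreeCycle → SharesArc t r →
      g * t * g⁻¹ = t ∨ g * t⁻¹ * g⁻¹ = t) : g = 1 := by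
  refine eq_one_of_preserves_support hα hr fun t ht htr x hx hgx => hx ?_
  rcases h t ht htr with h2 | h2 <;> rw [mul_inv_eq_iff_eq_mul] at h2 <;>
    have h3 := Equiv.congr_fun h2 x <;>
    simp only [Perm.mul_apply, hgx, EmbeddingLike.apply_eq_iff_eq] at h3
  · exact h3
  · exact (Perm.inv_eq_iff_eq.1 h3).symm

theorem exists_isThreeCycle (hα : 5 ≤ Fintype.card α) : ∃ r : Perm α, r.IsThreeCycle := by
  obtain ⟨i, hi⟩ := exists_ne_of_card (s := (∅ : Finset α)) (by rw [Finset.card_empty]; omega)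
  obtain ⟨j, hj⟩ := exists_ne_of_card (s := {i}) (by rw [Finset.card_singleton]; omega)
  obtain ⟨r, -, hr, -⟩ := exists_isThreeCycle_pair hα (i := i) (j := j)
    (fun h => hj (by simp [h])) i
  exact ⟨r, hr⟩

theorem not_forall_conj_inv_eq (hα : 5 ≤ Fintype.card α) (g : Perm α) :
    ¬ ∀ t : Perm α, t.IsThreeCycle → g * t⁻¹ * g⁻¹ = t := by
  intro h
  obtain ⟨r, hr⟩ := exists_isThreeCycle hα
  obtain rfl := eq_one_of_conj_eq_or hα hr fun t ht _ => Or.inr (h t ht)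
  apply not_sharesArc_inv hr
  have := h r hr
  rw [one_mul, inv_one, mul_one] at this
  rw [this]
  exact sharesArc_refl hr

end CompleteAlternating

/-! ### Classification of the automorphisms of the graph -/

namespace CompleteAlternating

open Equiv

theorem CAG_adj {n : ℕ} {x y : alternatingGroup (Fin n)} :
    (CAG n).Adj x y ↔ ((y : Perm (Fin n)) * (x : Perm (Fin n))⁻¹).IsThreeCycle := by
  have key : ∀ x y : alternatingGroup (Fin n), (∃ t ∈ threeCycles n, y = t * x) ↔
      ((y : Perm (Fin n)) * (x : Perm (Fin n))⁻¹).IsThreeCycle := fun x y =>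
    ⟨fun ⟨t, ht, h⟩ => by
      subst h
      rw [Subgroup.coe_mul, mul_inv_cancel_right]
      exact ht, fun h => ⟨y * x⁻¹, h, by simp⟩⟩
  rw [CAG, cayleyGraph, SimpleGraph.fromRel_adj, key, key]
  constructor
  · rintro ⟨-, h | h⟩
    · exact h
    · simpa using h.inv
  · refine fun h => ⟨?_, Or.inl h⟩
    rintro rfl
    simpa using h.ne_one

variable {n : ℕ}

/-- Right multiplication by `c`, as an automorphism of `CAG n`. -/
def mulRightIso (c : alternatingGroup (Fin n)) : CAG n ≃g CAG n where
  toEquiv := Equiv.mulRight c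
  map_rel_iff' := by
    intro x y
    simp [CAG_adj, mul_assoc]

/-- Conjugation by `g`, as an automorphism of `CAG n`. -/
def conjIso (g : Perm (Fin n)) : CAG n ≃g CAG n where
  toEquiv := (MulAut.conjNormal g : MulAut (alternatingGroup (Fin n))).toEquiv
  map_rel_iff' := by
    intro x y
    simp only [CAG_adj, MulEquiv.toEquiv_eq_coe, EquivLike.coe_coe, MulAut.conjNormal_apply]
    rw [show g * (y : Perm (Fin n)) * g⁻¹ * (g * (x : Perm (Fin n)) * g⁻¹)⁻¹ =
      g * ((y : Perm (Fin n)) * (x : Perm (Fin n))⁻¹) * g⁻¹ by group,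
      Perm.IsThreeCycle, Perm.IsThreeCycle, Perm.cycleType_conj]

/-- Inversion, as an automorphism of `CAG n`. -/
def inversionIso (n : ℕ) : CAG n ≃g CAG n where
  toEquiv := inversion n
  map_rel_iff' := by
    intro x y
    simp only [CAG_adj, inversion, Equiv.inv_apply, Subgroup.coe_inv, inv_inv]
    rw [show (y : Perm (Fin n))⁻¹ * x = (y : Perm (Fin n))⁻¹ * (y * (x : Perm (Fin n))⁻¹)⁻¹ *
      (y : Perm (Fin n))⁻¹⁻¹ by group, Perm.IsThreeCycle, Perm.IsThreeCycle, Perm.cycleType_conj,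
      Perm.cycleType_inv]

@[simp] theorem mulRightIso_apply (c x : alternatingGroup (Fin n)) :
    mulRightIso c x = x * c := rfl

@[simp] theorem coe_conjIso_apply (g : Perm (Fin n)) (x : alternatingGroup (Fin n)) :
    (conjIso g x : Perm (Fin n)) = g * x * g⁻¹ := rfl

@[simp] theorem inversionIso_apply (x : alternatingGroup (Fin n)) : inversionIso n x = x⁻¹ := rfl

theorem mem_alternatingGroup_of_isThreeCycle {a : Perm (Fin n)} (ha : a.IsThreeCycle) :
    a ∈ alternatingGroup (Fin n) :=
  Perm.mem_alternatingGroup.2 ha.sign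

/-- Automorphisms fixing the identity act on 3-cycles as conjugations, possibly composed with
inversion. -/
theorem exists_conj_of_fixes_one (hn : 5 ≤ n) (φ : CAG n ≃g CAG n) (h1 : φ 1 = 1) :
    ∃ g : Perm (Fin n), (∀ a ∈ threeCycles n, φ a = conjIso g a) ∨
      (∀ a ∈ threeCycles n, φ a = conjIso g a⁻¹) := by
  have hcard : 5 ≤ Fintype.card (Fin n) := by simpa using hn
  have adj : ∀ a b : alternatingGroup (Fin n),
      ((φ b : Perm (Fin n)) * (φ a : Perm (Fin n))⁻¹).IsThreeCycle ↔
      ((b : Perm (Fin n)) * (a : Perm (Fin n))⁻¹).IsThreeCycle := fun a b => by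
    rw [← CAG_adj, ← CAG_adj, φ.map_adj_iff]
  have three : ∀ a, (φ a : Perm (Fin n)).IsThreeCycle ↔ (a : Perm (Fin n)).IsThreeCycle := by
    intro a
    simpa [h1] using adj 1 a
  have share : ∀ a b : alternatingGroup (Fin n), (a : Perm (Fin n)).IsThreeCycle →
      (b : Perm (Fin n)).IsThreeCycle →
      (SharesArc (φ a : Perm (Fin n)) (φ b) ↔ SharesArc (a : Perm (Fin n)) b) := by
    intro a b ha hb
    by_cases hab : a = b
    · subst hab
      exact iff_of_true (sharesArc_refl ((three a).2 ha)) (sharesArc_refl ha)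
    rw [sharesArc_iff_exists_common_neighbor hcard ha hb (fun h => hab (Subtype.ext h)),
      sharesArc_iff_exists_common_neighbor hcard ((three a).2 ha) ((three b).2 hb)
      (fun h => hab (φ.injective (Subtype.ext h))), adj]
    refine and_congr_right fun _ => ⟨?_, ?_⟩
    · rintro ⟨c, hc, h2, h3⟩
      obtain ⟨d, hd⟩ := φ.surjective ⟨c, mem_alternatingGroup_of_isThreeCycle hc⟩
      obtain rfl : (φ d : Perm (Fin n)) = c := congrArg Subtype.val hd
      exact ⟨d, (three d).1 hc, (adj _ _).1 h2, (adj _ _).1 h3⟩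
    · rintro ⟨c, hc, h2, h3⟩
      lift c to alternatingGroup (Fin n) using mem_alternatingGroup_of_isThreeCycle hc
      exact ⟨φ c, (three c).2 hc, (adj _ _).2 h2, (adj _ _).2 h3⟩
  -- The only 3-cycle adjacent to a that shares no arc with it is a⁻¹.
  have inv : ∀ a : alternatingGroup (Fin n), (a : Perm (Fin n)).IsThreeCycle →
      φ a⁻¹ = (φ a)⁻¹ := by
    intro a ha
    have hne' : (a : Perm (Fin n)) ≠ (a : Perm (Fin n))⁻¹ := fun h =>
      not_sharesArc_inv ha (h ▸ sharesArc_refl ha)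
    have hne : a ≠ a⁻¹ := fun h => hne' (congrArg Subtype.val h)
    have h2 := (isThreeCycle_mul_inv_iff ha ha.inv hne').2
      (Or.inl rfl)
    have h3 := (adj a a⁻¹).2 h2
    rw [isThreeCycle_mul_inv_iff ((three a).2 ha) ((three a⁻¹).2 ha.inv)
      (fun h => hne (φ.injective (Subtype.ext h))), share a a⁻¹ ha ha.inv] at h3
    exact Subtype.ext (h3.resolve_right (not_sharesArc_inv ha))
  -- The default value 1 off `A_n` is harmless: all 3-cycles are even.
  let f : Perm (Fin n) → Perm (Fin n) :=
    Function.extend Subtype.val (fun a => (φ a : Perm (Fin n))) 1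
  have hf : ∀ a : alternatingGroup (Fin n), f a = φ a := fun a =>
    Subtype.val_injective.extend_apply _ _ a
  have harc : ArcPreserving f := by
    refine ⟨?_, ?_, ?_, ?_⟩
    · intro a ha
      lift a to alternatingGroup (Fin n) using mem_alternatingGroup_of_isThreeCycle ha
      rw [hf, three]
      exact ha
    · intro a b ha hb h
      lift a to alternatingGroup (Fin n) using mem_alternatingGroup_of_isThreeCycle ha
      lift b to alternatingGroup (Fin n) using mem_alternatingGroup_of_isThreeCycle hb
      rw [hf, hf] at h
      rw [φ.injective (Subtype.ext h)]
    · intro a ha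
      lift a to alternatingGroup (Fin n) using mem_alternatingGroup_of_isThreeCycle ha
      rw [← Subgroup.coe_inv, hf, hf, inv a ha, Subgroup.coe_inv]
    · intro a b ha hb
      lift a to alternatingGroup (Fin n) using mem_alternatingGroup_of_isThreeCycle ha
      lift b to alternatingGroup (Fin n) using mem_alternatingGroup_of_isThreeCycle hb
      rw [hf, hf, share a b ha hb]
  obtain ⟨g, hg⟩ := harc.exists_conj hcard
  refine ⟨g, hg.imp (fun h a ha => Subtype.ext ?_) fun h a ha => Subtype.ext ?_⟩
  · rw [← hf, h _ ha, coe_conjIso_apply]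
  · rw [← hf, h _ ha, coe_conjIso_apply, Subgroup.coe_inv]

/-- An automorphism fixing `1` and all 3-cycles fixes all the neighbours of 3-cycles. -/
theorem fixes_mul_of_fixes_threeCycles (hn : 5 ≤ n) (φ : CAG n ≃g CAG n) (h1 : φ 1 = 1)
    (hφ : ∀ a ∈ threeCycles n, φ a = a) {s : alternatingGroup (Fin n)} (hs : s ∈ threeCycles n)
    {t : alternatingGroup (Fin n)} (ht : t ∈ threeCycles n) : φ (t * s) = t * s := by
  have hs' : (s : Perm (Fin n)).IsThreeCycle := hs
  -- ψ is φ seen from s: the neighbours t * s of s become the 3-cycles t.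
  let ψ : CAG n ≃g CAG n := mulRightIso s⁻¹ * φ * mulRightIso s
  have hψ : ∀ x, ψ x = φ (x * s) * s⁻¹ := fun _ => rfl
  -- If u shares an arc with s⁻¹, then u * s is 1 or a 3-cycle, so φ fixes it.
  have hfix : ∀ u ∈ threeCycles n, SharesArc (u : Perm (Fin n)) (s : Perm (Fin n))⁻¹ →
      ψ u = u := by
    intro u hu hus
    have hu' : (u : Perm (Fin n)).IsThreeCycle := hu
    rw [hψ, mul_inv_eq_iff_eq_mul]
    by_cases hne : u = s⁻¹
    · rw [hne, inv_mul_cancel, h1]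
    apply hφ
    have := (isThreeCycle_mul_inv_iff hs'.inv hu' (by
      rw [← Subgroup.coe_inv]
      exact fun h => hne (Subtype.ext h.symm))).2 (Or.inr hus.symm)
    simpa [threeCycles] using this
  have hone : ψ 1 = 1 := by rw [hψ, one_mul, hφ s hs, mul_inv_cancel]
  obtain ⟨g, hg⟩ := exists_conj_of_fixes_one hn ψ hone
  have hg1 : g = 1 := by
    refine eq_one_of_conj_eq_or (by simpa using hn) hs'.inv fun u hu hus => ?_
    lift u to alternatingGroup (Fin n) using mem_alternatingGroup_of_isThreeCycle hu
    have h2 := hfix u hu hus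
    refine hg.imp (fun hg => ?_) fun hg => ?_ <;>
      rw [hg u hu, Subtype.ext_iff, coe_conjIso_apply] at h2 <;> exact h2
  subst hg1
  rcases hg with hg | hg
  · have := hg t ht
    rw [hψ, mul_inv_eq_iff_eq_mul] at this
    rw [this]
    simp [Subtype.ext_iff]
  -- Inversion is ruled out at s⁻¹, which ψ fixes and which differs from s.
  · exfalso
    have h2 := hg s⁻¹ hs'.inv
    rw [hfix s⁻¹ hs'.inv (by simpa using sharesArc_refl hs'.inv)] at h2
    apply not_sharesArc_inv hs'
    have h3 : (s : Perm (Fin n))⁻¹ = s := by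
      simpa [Subtype.ext_iff] using h2
    rw [h3]
    exact sharesArc_refl hs'

theorem eq_one_of_fixes_threeCycles (hn : 5 ≤ n) (φ : CAG n ≃g CAG n) (h1 : φ 1 = 1)
    (hφ : ∀ a ∈ threeCycles n, φ a = a) (x : alternatingGroup (Fin n)) : φ x = x := by
  have hx : (x : Perm (Fin n)) ∈ Subgroup.closure {σ : Perm (Fin n) | σ.IsThreeCycle} := by
    rw [Perm.closure_three_cycles_eq_alternating]
    exact x.2
  -- The induction carries a vertex together with all its neighbours; right translation by y reduces
  -- the step to y = 1.
  have step : ∀ y : alternatingGroup (Fin n), (φ y = y ∧ ∀ a ∈ threeCycles n, φ (a * y) = a * y) →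
      ∀ s ∈ threeCycles n, φ (s * y) = s * y ∧ ∀ a ∈ threeCycles n, φ (a * (s * y)) = a * (s * y) := by
    rintro y ⟨hy, hy'⟩ s hs
    refine ⟨hy' s hs, fun a ha => ?_⟩
    have := fixes_mul_of_fixes_threeCycles hn (mulRightIso y⁻¹ * φ * mulRightIso y)
      (show φ (1 * y) * y⁻¹ = 1 by rw [one_mul, hy, mul_inv_cancel])
      (fun b hb => show φ (b * y) * y⁻¹ = b by rw [hy' b hb, mul_inv_cancel_right]) hs ha
    change φ (a * s * y) * y⁻¹ = a * s at this
    rwa [mul_inv_eq_iff_eq_mul, mul_assoc] at this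
  have key : ∀ z ∈ Subgroup.closure {σ : Perm (Fin n) | σ.IsThreeCycle},
      ∃ y : alternatingGroup (Fin n), (y : Perm (Fin n)) = z ∧ φ y = y ∧
        ∀ a ∈ threeCycles n, φ (a * y) = a * y := by
    intro z hz
    induction hz using Subgroup.closure_induction_left with
    | one => exact ⟨1, rfl, h1, fun a ha => by rw [mul_one, hφ a ha]⟩
    | mul_left s hs z hz ih =>
      obtain ⟨y, rfl, hy⟩ := ih
      exact ⟨⟨s, mem_alternatingGroup_of_isThreeCycle hs⟩ * y, rfl, step y hy _ hs⟩
    | inv_mul_cancel s hs z hz ih =>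
      obtain ⟨y, rfl, hy⟩ := ih
      exact ⟨⟨s, mem_alternatingGroup_of_isThreeCycle hs⟩⁻¹ * y, rfl, step y hy _
        (Perm.IsThreeCycle.inv (show Perm.IsThreeCycle s from hs))⟩
  obtain ⟨y, hy, hy', -⟩ := key _ hx
  rwa [Subtype.ext hy] at hy'

/-- Every automorphism of `CAG n` is `x ↦ g x^{±1} g⁻¹ c`. -/
theorem automorphism_classification (hn : 5 ≤ n) (φ : CAG n ≃g CAG n) :
    ∃ g : Perm (Fin n), (∀ x, φ x = conjIso g x * φ 1) ∨ (∀ x, φ x = conjIso g x⁻¹ * φ 1) := by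
  obtain ⟨g, hg⟩ := exists_conj_of_fixes_one hn (mulRightIso (φ 1)⁻¹ * φ) (mul_inv_cancel (φ 1))
  have hinv : ∀ x, conjIso g⁻¹ (conjIso g x) = x := fun x => by
    simp [Subtype.ext_iff, mul_assoc]
  have hinv' : ∀ x, conjIso g (conjIso g⁻¹ x) = x := fun x => by
    simp [Subtype.ext_iff, mul_assoc]
  have hone : conjIso g⁻¹ (φ 1 * (φ 1)⁻¹) = 1 := by simp [Subtype.ext_iff]
  refine ⟨g, hg.imp (fun h x => ?_) fun h x => ?_⟩
  · have : conjIso g⁻¹ (φ x * (φ 1)⁻¹) = x :=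
      eq_one_of_fixes_threeCycles hn (conjIso g⁻¹ * (mulRightIso (φ 1)⁻¹ * φ)) hone
        (fun a ha => (congrArg (conjIso g⁻¹) (h a ha)).trans (hinv a)) x
    rw [← mul_inv_eq_iff_eq_mul, ← hinv' (φ x * _), this]
  · have : (conjIso g⁻¹ (φ x * (φ 1)⁻¹))⁻¹ = x :=
      eq_one_of_fixes_threeCycles hn
        (inversionIso n * (conjIso g⁻¹ * (mulRightIso (φ 1)⁻¹ * φ))) (inv_eq_one.2 hone)
        (fun a ha => inv_eq_iff_eq_inv.2 ((congrArg (conjIso g⁻¹) (h a ha)).trans (hinv a⁻¹))) x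
    rw [← mul_inv_eq_iff_eq_mul, ← hinv' (φ x * _), ← inv_eq_iff_eq_inv.1 this]

end CompleteAlternating

/-! ### Internal and external semidirect products -/

namespace CompleteAlternating

open Equiv

theorem IsInternalSemidirect.of_le_normalizer {P : Type*} [Group P] {N H G : Subgroup P}
    (hN : N ≤ G) (hH : H ≤ G) (hG : G ≤ Subgroup.normalizer (N : Set P)) (hd : Disjoint N H)
    (hmul : ∀ g ∈ G, ∃ a ∈ N, ∃ b ∈ H, g = a * b) : IsInternalSemidirect N H G := by
  refine ⟨hN, hH, (Subgroup.normal_subgroupOf_iff_le_normalizer hN).2 hG,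
    Subgroup.isComplement'_of_disjoint_and_mul_eq_univ ?_ ?_⟩
  · rw [Subgroup.disjoint_def] at hd ⊢
    exact fun {x} h1 h2 => Subtype.ext (hd h1 h2)
  · refine Set.eq_univ_of_forall fun ⟨g, hg⟩ => ?_
    obtain ⟨a, ha, b, hb, rfl⟩ := hmul g hg
    exact ⟨⟨a, hN ha⟩, ha, ⟨b, hH hb⟩, hb, rfl⟩

variable {n : ℕ}

theorem inn_le_normalizer_rightRegular :
    innOnAlternating n ≤ Subgroup.normalizer
      (rightRegular (alternatingGroup (Fin n)) : Set (Perm (alternatingGroup (Fin n)))) := by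
  have key : ∀ f ∈ innOnAlternating n, ∀ r ∈ rightRegular (alternatingGroup (Fin n)),
      f * r * f⁻¹ ∈ rightRegular (alternatingGroup (Fin n)) := by
    rintro f ⟨g, hg⟩ r ⟨c, hc⟩
    refine ⟨f c, fun x => ?_⟩
    obtain ⟨y, rfl⟩ := f.surjective x
    rw [Perm.mul_apply, Perm.mul_apply, show f⁻¹ (f y) = y from f.symm_apply_apply y, hc]
    apply Subtype.ext
    rw [Subgroup.coe_mul, hg, hg, hg, Subgroup.coe_mul, map_mul]
  intro f hf
  rw [Subgroup.mem_normalizer_iff]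
  refine fun r => ⟨key f hf r, fun h => ?_⟩
  have := key f⁻¹ (inv_mem hf) _ h
  rwa [show f⁻¹ * (f * r * f⁻¹) * f⁻¹⁻¹ = r by group] at this

theorem mem_rightRegular_sup_inn {f : Perm (alternatingGroup (Fin n))} :
    f ∈ rightRegular (alternatingGroup (Fin n)) ⊔ innOnAlternating n ↔
      ∃ (g : Perm (Fin n)) (c : alternatingGroup (Fin n)), ∀ x, f x = conjIso g x * c := by
  rw [sup_comm, ← SetLike.mem_coe,
    Subgroup.coe_mul_of_left_le_normalizer_right _ _ inn_le_normalizer_rightRegular]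
  constructor
  · rintro ⟨p, ⟨g, hg⟩, r, ⟨c, hc⟩, rfl⟩
    refine ⟨g, p c, fun x => Subtype.ext ?_⟩
    change ((p (r x) : alternatingGroup (Fin n)) : Perm (Fin n)) = _
    rw [hc, hg, Subgroup.coe_mul, Subgroup.coe_mul, hg, map_mul]
    rfl
  · rintro ⟨g, c, h⟩
    refine ⟨(conjIso g).toEquiv, ⟨g, fun x => rfl⟩, Equiv.mulRight (conjIso g⁻¹ c),
      ⟨_, fun x => rfl⟩, Equiv.ext fun x => ?_⟩
    rw [h]
    apply Subtype.ext
    change g * ((x : Perm (Fin n)) * (g⁻¹ * c * g⁻¹⁻¹)) * g⁻¹ = g * x * g⁻¹ * c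
    group

theorem isInternalSemidirect_rightRegular_inn :
    IsInternalSemidirect (rightRegular (alternatingGroup (Fin n))) (innOnAlternating n)
      (rightRegular (alternatingGroup (Fin n)) ⊔ innOnAlternating n) := by
  refine .of_le_normalizer le_sup_left le_sup_right
    (sup_le Subgroup.le_normalizer inn_le_normalizer_rightRegular) ?_ ?_
  · rw [Subgroup.disjoint_def]
    rintro f ⟨c, hc⟩ ⟨g, hg⟩
    have h1 := hg 1
    rw [hc, one_mul, Subgroup.coe_one, map_one] at h1
    obtain rfl : c = 1 := Subtype.ext h1
    exact Equiv.ext fun x => by rw [hc, mul_one, Perm.one_apply]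
  · intro f hf
    obtain ⟨g, c, h⟩ := mem_rightRegular_sup_inn.1 hf
    exact ⟨Equiv.mulRight c, ⟨c, fun x => rfl⟩, (conjIso g).toEquiv, ⟨g, fun x => rfl⟩,
      Equiv.ext h⟩

theorem inversion_sq : inversion n * inversion n = 1 :=
  Equiv.ext fun x => inv_inv x

theorem not_forall_conjIso_inv_eq (hn : 5 ≤ n) (g : Perm (Fin n)) :
    ¬ ∀ x, conjIso g x⁻¹ = x := by
  refine fun h => not_forall_conj_inv_eq (by simpa using hn) g fun t ht => ?_
  exact congrArg Subtype.val (h ⟨t, mem_alternatingGroup_of_isThreeCycle ht⟩)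

theorem orderOf_inversion (hn : 5 ≤ n) : orderOf (inversion n) = 2 := by
  refine orderOf_eq_prime (by rw [pow_two, inversion_sq]) fun h => ?_
  refine not_forall_conjIso_inv_eq hn 1 fun x => ?_
  have h1 : x⁻¹ = x := Equiv.congr_fun h x
  rw [h1]
  simp [Subtype.ext_iff]

theorem mem_zpowers_inversion {f : Perm (alternatingGroup (Fin n))} :
    f ∈ Subgroup.zpowers (inversion n) ↔ f = 1 ∨ f = inversion n := by
  constructor
  · rintro ⟨k, rfl⟩
    dsimp only
    rcases Int.even_or_odd' k with ⟨m, rfl | rfl⟩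
    · left
      rw [zpow_mul, zpow_two, inversion_sq, one_zpow]
    · right
      rw [zpow_add, zpow_mul, zpow_two, inversion_sq, one_zpow, one_mul, zpow_one]
  · rintro (rfl | rfl)
    · exact one_mem _
    · exact Subgroup.mem_zpowers _

theorem inversion_mem_normalizer : inversion n ∈ Subgroup.normalizer
    ((rightRegular (alternatingGroup (Fin n)) ⊔ innOnAlternating n : Subgroup _) :
      Set (Perm (alternatingGroup (Fin n)))) := by
  have hinv : (inversion n)⁻¹ = inversion n := inv_eq_of_mul_eq_one_left inversion_sq
  have key : ∀ f ∈ rightRegular (alternatingGroup (Fin n)) ⊔ innOnAlternating n,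
      inversion n * f * (inversion n)⁻¹ ∈
        rightRegular (alternatingGroup (Fin n)) ⊔ innOnAlternating n := by
    intro f hf
    obtain ⟨g, c, h⟩ := mem_rightRegular_sup_inn.1 hf
    -- (g x⁻¹ g⁻¹ c)⁻¹ = (c⁻¹g) x (c⁻¹g)⁻¹ c⁻¹; with c = a⁻¹ this is the formula of `twist`.
    refine mem_rightRegular_sup_inn.2 ⟨(c : Perm (Fin n))⁻¹ * g, c⁻¹, fun x => ?_⟩
    rw [hinv]
    change (f x⁻¹)⁻¹ = _
    rw [h]
    apply Subtype.ext
    simp [mul_assoc]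
  rw [Subgroup.mem_normalizer_iff]
  refine fun f => ⟨key f, fun h => ?_⟩
  have h1 := key _ h
  have h2 : inversion n * (inversion n * f * (inversion n)⁻¹) * (inversion n)⁻¹ =
      inversion n * inversion n * f * (inversion n * inversion n)⁻¹ := by group
  rwa [h2, inversion_sq, one_mul, inv_one, mul_one] at h1

theorem isInternalSemidirect_autGroup (hn : 5 ≤ n) :
    IsInternalSemidirect (rightRegular (alternatingGroup (Fin n)) ⊔ innOnAlternating n)
      (Subgroup.zpowers (inversion n)) (autGroup (CAG n)) := by
  have hmul : ∀ f ∈ autGroup (CAG n),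
      ∃ a ∈ rightRegular (alternatingGroup (Fin n)) ⊔ innOnAlternating n,
      ∃ b ∈ Subgroup.zpowers (inversion n), f = a * b := by
    rintro _ ⟨φ, rfl⟩
    obtain ⟨g, h | h⟩ := automorphism_classification hn φ
    · exact ⟨φ.toEquiv, mem_rightRegular_sup_inn.2 ⟨g, _, h⟩, 1, one_mem _, (mul_one _).symm⟩
    · refine ⟨φ.toEquiv * inversion n, mem_rightRegular_sup_inn.2 ⟨g, φ 1, fun x => ?_⟩,
        inversion n, Subgroup.mem_zpowers _, by rw [mul_assoc, inversion_sq, mul_one]⟩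
      change φ x⁻¹ = _
      rw [h, inv_inv]
  refine .of_le_normalizer ?_ ?_ ?_ ?_ hmul
  · intro f hf
    obtain ⟨g, c, h⟩ := mem_rightRegular_sup_inn.1 hf
    exact ⟨mulRightIso c * conjIso g, Equiv.ext fun x => (h x).symm⟩
  · rw [Subgroup.zpowers_le]
    exact ⟨inversionIso n, rfl⟩
  · intro f hf
    obtain ⟨a, ha, b, hb, rfl⟩ := hmul f hf
    exact mul_mem (Subgroup.le_normalizer ha)
      (Subgroup.zpowers_le.2 inversion_mem_normalizer hb)
  · rw [Subgroup.disjoint_def]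
    intro f hf hf'
    refine (mem_zpowers_inversion.1 hf').resolve_right ?_
    rintro rfl
    -- Evaluation at 1 gives c = 1, so conjugation by g would invert every element.
    obtain ⟨g, c, h⟩ := mem_rightRegular_sup_inn.1 hf
    change ∀ x : alternatingGroup (Fin n), x⁻¹ = _ at h
    have h1 := h 1
    rw [show conjIso g 1 = 1 by simp [Subtype.ext_iff], one_mul, inv_one] at h1
    refine not_forall_conjIso_inv_eq hn g fun x => ?_
    have h2 := h x⁻¹
    rw [← h1, mul_one, inv_inv] at h2
    exact h2.symm

/-- The homomorphism `a ↦ (x ↦ x * a⁻¹)`. -/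
def mulRightHom (n : ℕ) : alternatingGroup (Fin n) →* (CAG n ≃g CAG n) where
  toFun a := mulRightIso a⁻¹
  map_one' := RelIso.ext fun x => by simp
  map_mul' a b := RelIso.ext fun x => by simp [mul_assoc]

/-- The homomorphism `g ↦ (x ↦ g * x * g⁻¹)`. -/
def conjHom (n : ℕ) : Perm (Fin n) →* (CAG n ≃g CAG n) where
  toFun := conjIso
  map_one' := RelIso.ext fun x => Subtype.ext (by simp)
  map_mul' a b := RelIso.ext fun x => Subtype.ext (by simp [mul_assoc])

theorem inversionIso_sq : inversionIso n ^ 2 = 1 :=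
  RelIso.ext fun x => by simp [pow_two]

/-- The homomorphism from `ℤ/2` sending the generator to inversion. -/
def inversionHom (n : ℕ) : Multiplicative (ZMod 2) →* (CAG n ≃g CAG n) where
  toFun t := inversionIso n ^ t.toAdd.val
  map_one' := by simp
  map_mul' s t := by
    rw [toAdd_mul, ZMod.val_add, ← pow_eq_pow_mod _ inversionIso_sq, pow_add]

/-- The action of `A_n ⋊ S_n` on `CAG n`. -/
def altSemidirectSymHom (n : ℕ) : AltSemidirectSym n →* (CAG n ≃g CAG n) :=
  SemidirectProduct.lift (mulRightHom n) (conjHom n) fun g => by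
    ext a x : 2
    rw [MonoidHom.comp_apply, MonoidHom.comp_apply, MulEquiv.coe_toMonoidHom,
      MulEquiv.coe_toMonoidHom, MulAut.conj_apply, ← map_inv]
    apply Subtype.ext
    simp [mulRightHom, conjHom, mul_assoc]

theorem altSemidirectSymHom_apply (p : AltSemidirectSym n) (x : alternatingGroup (Fin n)) :
    altSemidirectSymHom n p x = conjIso p.right x * p.left⁻¹ := rfl

theorem eq_one_or_eq_generator (t : Multiplicative (ZMod 2)) :
    t = 1 ∨ t = Multiplicative.ofAdd 1 := by
  revert t
  decide

theorem inversionHom_generator (x : alternatingGroup (Fin n)) :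
    inversionHom n (Multiplicative.ofAdd 1) x = x⁻¹ := rfl

/-- The action of `(A_n ⋊ S_n) ⋊ ℤ/2` on `CAG n`. -/
def altSymTwoHom (n : ℕ) : AltSymTwo n →* (CAG n ≃g CAG n) :=
  SemidirectProduct.lift (altSemidirectSymHom n) (inversionHom n) fun t => by
    rcases eq_one_or_eq_generator t with rfl | rfl
    · ext p : 1
      simp
    · refine MonoidHom.ext fun p => RelIso.ext fun x => ?_
      rw [MonoidHom.comp_apply, MonoidHom.comp_apply, MulEquiv.coe_toMonoidHom,
        MulEquiv.coe_toMonoidHom, MulAut.conj_apply, ← map_inv, ← ofAdd_neg]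
      change altSemidirectSymHom n (twist n p) x = (altSemidirectSymHom n p x⁻¹)⁻¹
      rw [altSemidirectSymHom_apply, altSemidirectSymHom_apply]
      apply Subtype.ext
      simp [twist, mul_assoc]

theorem altSymTwoHom_apply (q : AltSymTwo n) (x : alternatingGroup (Fin n)) :
    altSymTwoHom n q x = conjIso q.left.right (inversionHom n q.right x) * q.left.left⁻¹ := rfl

/-- Surjectivity is the classification. For a kernel element, evaluation at 1 gives a = 1; then g
centralizes all 3-cycles, so g = 1, or conjugation by g inverts everything, which is impossible. -/
theorem altSymTwoHom_bijective (hn : 5 ≤ n) : Function.Bijective (altSymTwoHom n) := by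
  have hcard : 5 ≤ Fintype.card (Fin n) := by simpa using hn
  have hone : ∀ g : Perm (Fin n), conjIso g 1 = 1 := fun g => by simp [Subtype.ext_iff]
  constructor
  · rw [injective_iff_map_eq_one]
    rintro ⟨⟨a, g⟩, t⟩ h
    have h1 : ∀ x, conjIso g (inversionHom n t x) * a⁻¹ = x := fun x => by
      rw [← altSymTwoHom_apply (⟨⟨a, g⟩, t⟩ : AltSymTwo n), h, RelIso.one_apply]
    rcases eq_one_or_eq_generator t with rfl | rfl
    · simp only [map_one, RelIso.one_apply] at h1
      have ha := h1 1
      rw [hone, one_mul, inv_eq_one] at ha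
      subst ha
      obtain ⟨r, hr⟩ := exists_isThreeCycle hcard
      obtain rfl : g = 1 := eq_one_of_conj_eq_or hcard hr fun t ht _ => Or.inl (by
        have := congrArg Subtype.val (h1 ⟨t, mem_alternatingGroup_of_isThreeCycle ht⟩)
        simpa using this)
      rfl
    · simp only [inversionHom_generator] at h1
      have ha := h1 1
      rw [inv_one, hone, one_mul, inv_eq_one] at ha
      subst ha
      exact absurd (fun x => by simpa using h1 x) (not_forall_conjIso_inv_eq hn g)
  · intro φ
    obtain ⟨g, h | h⟩ := automorphism_classification hn φ
    · refine ⟨⟨⟨(φ 1)⁻¹, g⟩, 1⟩, RelIso.ext fun x => ?_⟩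
      rw [altSymTwoHom_apply, h x, inv_inv, map_one (inversionHom n), RelIso.one_apply]
    · refine ⟨⟨⟨(φ 1)⁻¹, g⟩, Multiplicative.ofAdd 1⟩, RelIso.ext fun x => ?_⟩
      rw [altSymTwoHom_apply, h x, inv_inv, inversionHom_generator]

theorem card_altSymTwo (hn : 5 ≤ n) : Nat.card (AltSymTwo n) = n.factorial ^ 2 := by
  have : Nontrivial (Fin n) := Fin.nontrivial_iff_two_le.2 (by omega)
  rw [Nat.card_congr SemidirectProduct.equivProd, Nat.card_prod,
    Nat.card_congr SemidirectProduct.equivProd, Nat.card_prod, mul_right_comm, mul_comm (Nat.card _),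
    show Nat.card (Multiplicative (ZMod 2)) = 2 from Nat.card_zmod 2,
    two_mul_nat_card_alternatingGroup, Nat.card_perm, Nat.card_fin, pow_two]

end CompleteAlternating

theorem theorem3p1 (n : ℕ) (hn : 5 ≤ n) :
    -- the internal decomposition of the automorphism group, with a factor of order two on the right
    IsInternalSemidirect
      (rightRegular (alternatingGroup (Fin n))) (innOnAlternating n)
      (rightRegular (alternatingGroup (Fin n)) ⊔ innOnAlternating n) ∧
    IsInternalSemidirect
      (rightRegular (alternatingGroup (Fin n)) ⊔ innOnAlternating n)
      (Subgroup.zpowers (inversion n)) (autGroup (CAG n)) ∧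
    orderOf (inversion n) = 2 ∧
    -- the isomorphism with the external semidirect product, factor by factor
    (∃ Φ : AltSymTwo n ≃* (CAG n ≃g CAG n),
      (∀ a x : alternatingGroup (Fin n),
        Φ (SemidirectProduct.inl (SemidirectProduct.inl a)) x = x * a⁻¹) ∧
      (∀ (g : Equiv.Perm (Fin n)) (x : alternatingGroup (Fin n)),
        (Φ (SemidirectProduct.inl (SemidirectProduct.inr g)) x : Equiv.Perm (Fin n))
          = g * x * g⁻¹) ∧
      (∀ x : alternatingGroup (Fin n),
        Φ (SemidirectProduct.inr (Multiplicative.ofAdd 1)) x = x⁻¹)) ∧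
    Nat.card (CAG n ≃g CAG n) = n.factorial ^ 2 := by
  refine ⟨isInternalSemidirect_rightRegular_inn, isInternalSemidirect_autGroup hn,
    orderOf_inversion hn, ⟨MulEquiv.ofBijective _ (altSymTwoHom_bijective hn), ?_, ?_, ?_⟩, ?_⟩
  · intro a x
    change altSymTwoHom n _ x = _
    apply Subtype.ext
    simp [altSymTwoHom_apply]
  · intro g x
    change ((altSymTwoHom n _ x : alternatingGroup (Fin n)) : Equiv.Perm (Fin n)) = _
    simp [altSymTwoHom_apply]
  · intro x
    change altSymTwoHom n _ x = _
    apply Subtype.ext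
    simp [altSymTwoHom_apply, inversionHom_generator]
  · rw [← Nat.card_congr (MulEquiv.ofBijective _ (altSymTwoHom_bijective hn)).toEquiv,
      card_altSymTwo hn]
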